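/- **Theorem 5.5.** Let $J=[n]\sqcup[n]^*$ with the involution $a\mapsto a^*$; a subset $A\subseteq J$ is *admissible* if $A\cap A^*=\emptyset$. For a matroid $\mathcal M$ on $J$ let $I^{ad}(\mathcal M)$ be the family of independent sets of $\mathcal M$ whose closure is admissible. A loopless matroid $\mathcal M$ on $J$ is called admissible if for every $A\subseteq J$ its rank $r(A)$ is the maximum, over all admissible independent sets $I\subseteq A$ of $\mathcal M$, of the number which is $|I|+2$ if there is $\{a,a^*\}\subseteq A$ with $I\cup\{a\},\,I\cup\{a^*\}\in I^{ad}(\mathcal M)$, and $|I|$ otherwise. Let $\mathcal S$ be a ranked symplectic matroid with enveloping matroid $\mathcal M$, that is, $\mathcal M$ is an admissible matroid on $J$ and $\mathcal S\neq\emptyset$ is the family of bases of $\mathcal M$ that are admissible sets. Let $L(\mathcal S)$ consist of $J$ and of all admissible flats of $\mathcal M$. For $A\subseteq J$ put $e^{\pm}_A=\sum_{i\in A\cap[n]}e_i-\sum_{i^*\in A\cap[n]^*}e_i\in\mathbb R^n$. Let $P(\mathcal S)$ be the convex hull of $\{e^{\pm}_B : B\in\mathcal S\}$. Its normal fan consists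 of the cones $\{\nu\in\mathbb R^n : \text{the functional } x\mapsto\sum_i x_i\nu_i \text{ attains its maximum over } P(\mathcal S) \text{ at every point of } Q\}$, where $Q$ runs through the nonempty faces of $P(\mathcal S)$. The Bergman fan $B(\mathcal S)$ is the collection of the cones $\bigl\{\sum_{F\in\mathcal F}a_F e^{\pm}_F : a_F\ge 0\bigr\}$, where $\mathcal F$ runs through the (possibly empty) chains $F_1\subsetneq\dots\subsetneq F_k$ in $L(\mathcal S)\setminus\{\emptyset,J\}$. Then $B(\mathcal S)$ is a refinement of a subfan of the normal fan of $P(\mathcal S)$. That is, $B(\mathcal S)$ is a polyhedral fan, and there is a polyhedral fan $\Sigma$, all of whose cones are cones of the normal fan of $P(\mathcal S)$, such that $B(\mathcal S)$ and $\Sigma$ have the same support and every cone of $B(\mathcal S)$ is contained in a cone of $\Sigma$. -/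

import Mathlib

/-- The ground set `J = [n] ⊔ [n]*`: `Sum.inl i` is the element `i`, `Sum.inr i` is `i*`, and the
involution `a ↦ a*` is `Sum.swap`. -/
abbrev SignedGround (n : ℕ) : Type := Fin n ⊕ Fin n

/-- `A ⊆ J` is admissible if `A ∩ A* = ∅`. -/
def AdmissibleSet {n : ℕ} (A : Set (SignedGround n)) : Prop :=
  ∀ a ∈ A, a.swap ∉ A

/-- The family `I^ad(M)` of independent sets of `M` with admissible closure. -/
def indepAd {n : ℕ} (M : Matroid (SignedGround n)) : Set (Set (SignedGround n)) :=
  {I | M.Indep I ∧ AdmissibleSet (M.closure I)}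

open Classical in
/-- The contribution of an admissible independent set `I ⊆ A` to the rank of `A`. -/
noncomputable def rankContribution {n : ℕ} (M : Matroid (SignedGround n))
    (A I : Set (SignedGround n)) : ℕ∞ :=
  if ∃ a ∈ A, a.swap ∈ A ∧ insert a I ∈ indepAd M ∧ insert a.swap I ∈ indepAd M then
    I.encard + 2
  else I.encard

/-- A loopless matroid on `J` is admissible if its rank function is derived from its family of
admissible independent sets: `r(A)` is the maximum of the contributions of the admissible
independent sets contained in `A`. -/
structure IsAdmissibleMatroid {n : ℕ} (M : Matroid (SignedGround n)) : Prop where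
  ground_eq : M.E = Set.univ
  loopless : M.Loopless
  rank_eq : ∀ A : Set (SignedGround n),
    IsGreatest {k : ℕ∞ | ∃ I ⊆ A, M.Indep I ∧ AdmissibleSet I ∧ k = rankContribution M A I}
      (M.eRk A)

/-- `S` (a family of bases) is a ranked symplectic matroid with enveloping matroid `M`:
`S` is the family of admissible bases of the admissible matroid `M`. As for every (symplectic)
matroid, the family of bases is nonempty. -/
structure IsRankedSymplectic {n : ℕ} (S : Set (Set (SignedGround n)))
    (M : Matroid (SignedGround n)) : Prop where
  admissible : IsAdmissibleMatroid M
  bases_eq : S = {B | M.IsBase B ∧ AdmissibleSet B}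
  nonempty : S.Nonempty

/-- The lattice of flats `L(S)`: the admissible flats of the enveloping matroid, and `J`. -/
def latticeOfFlats {n : ℕ} (M : Matroid (SignedGround n)) : Set (Set (SignedGround n)) :=
  {F | (M.IsFlat F ∧ AdmissibleSet F) ∨ F = Set.univ}

open Classical in
/-- The signed vector `e^±_A = ∑_{a ∈ A} sgn(a) e_a ∈ ℝⁿ`. -/
noncomputable def signedVec {n : ℕ} (A : Set (SignedGround n)) : Fin n → ℝ :=
  fun i => (if Sum.inl i ∈ A then 1 else 0) - (if Sum.inr i ∈ A then 1 else 0)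

/-- The matroid polytope `P(S)`: the convex hull of the points `e^±_B`, `B ∈ S`. -/
def matroidPolytope {n : ℕ} (S : Set (Set (SignedGround n))) : Set (Fin n → ℝ) :=
  convexHull ℝ (signedVec '' S)

/-- The face of `P` on which the linear functional `x ↦ ∑ xᵢ ωᵢ` attains its maximum. -/
def maxFace {n : ℕ} (P : Set (Fin n → ℝ)) (ω : Fin n → ℝ) : Set (Fin n → ℝ) :=
  {x | x ∈ P ∧ ∀ y ∈ P, y ⬝ᵥ ω ≤ x ⬝ᵥ ω}

/-- The (outer) normal cone of the face `maxFace P ω` of `P`: all functionals that attain their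
maximum over `P` at every point of that face. For a polytope it is the closure of the class of
functionals with the same maximal face as `ω`. -/
def normalCone {n : ℕ} (P : Set (Fin n → ℝ)) (ω : Fin n → ℝ) : PointedCone ℝ (Fin n → ℝ) where
  carrier := {ν | maxFace P ω ⊆ maxFace P ν}
  add_mem' := by
    intro a b ha hb x hx
    refine ⟨hx.1, fun y hy => ?_⟩
    rw [dotProduct_add, dotProduct_add]
    exact add_le_add ((ha hx).2 y hy) ((hb hx).2 y hy)
  zero_mem' := by
    intro x hx
    exact ⟨hx.1, fun y hy => by simp⟩
  smul_mem' := by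
    intro c a ha x hx
    refine ⟨hx.1, fun y hy => ?_⟩
    have h := mul_le_mul_of_nonneg_left ((ha hx).2 y hy) c.2
    have e : c • a = (c : ℝ) • a := rfl
    rw [e, dotProduct_smul, dotProduct_smul]
    exact h

/-- The normal fan of a polytope: the normal cones of its faces. -/
def normalFan {n : ℕ} (P : Set (Fin n → ℝ)) : Set (PointedCone ℝ (Fin n → ℝ)) :=
  Set.range (normalCone P)

/-- The Bergman fan `B(S)`: the order fan of the proper part of `L(S)`, whose cones are spanned
by the signed vectors `e^±_F` of the members of a (possibly empty) chain in `L(S) \ {∅, J}`. -/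
def bergmanFan {n : ℕ} (M : Matroid (SignedGround n)) : Set (PointedCone ℝ (Fin n → ℝ)) :=
  {σ | ∃ 𝓕 : Set (Set (SignedGround n)), 𝓕 ⊆ latticeOfFlats M \ {∅, Set.univ} ∧
    IsChain (· ⊆ ·) 𝓕 ∧ σ = PointedCone.hull ℝ (signedVec '' 𝓕)}

/-- A polyhedral fan: finitely many finitely generated cones, closed under taking faces, any two
of which meet in a common face. -/
structure IsFan {n : ℕ} (X : Set (PointedCone ℝ (Fin n → ℝ))) : Prop where
  finite : X.Finite
  fg : ∀ σ ∈ X, σ.FG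
  face_mem : ∀ σ ∈ X, ∀ τ : PointedCone ℝ (Fin n → ℝ), τ.IsFaceOf σ → τ ∈ X
  inter_face : ∀ σ ∈ X, ∀ τ ∈ X, (σ ⊓ τ).IsFaceOf σ ∧ (σ ⊓ τ).IsFaceOf τ

/-- The support of a collection of cones. -/
def fanSupport {n : ℕ} (X : Set (PointedCone ℝ (Fin n → ℝ))) : Set (Fin n → ℝ) :=
  ⋃ σ ∈ X, (σ : Set (Fin n → ℝ))

/-- `X` is a subfan of `Y`: a set of cones of `Y` that is itself a fan. -/
structure IsSubfan {n : ℕ} (X Y : Set (PointedCone ℝ (Fin n → ℝ))) : Prop where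
  subset : X ⊆ Y
  isFan : IsFan X

/-- The fan `X` refines the fan `Y`: they have the same support, and every cone of `X` lies in a
cone of `Y`. -/
structure FanRefines {n : ℕ} (X Y : Set (PointedCone ℝ (Fin n → ℝ))) : Prop where
  isFan_left : IsFan X
  isFan_right : IsFan Y
  support_eq : fanSupport X = fanSupport Y
  exists_le : ∀ σ ∈ X, ∃ τ ∈ Y, σ ≤ τ

/-!
Recording `ω` by the chain of sets `{a | t ≤ ±ω}`, `t > 0`, writes it as a positive combination of
signed vectors of admissible sets, and `ω` lies in the Bergman fan exactly when all these sets are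
flats. On admissible bases `B` the functional of an admissible set `G` is `|B ∩ G| - |B ∩ G*|`, and
admissibility of the matroid makes it possible to maximize `|B ∩ G|` and minimize `|B ∩ G*|` for
all members `G` of a chain by the same `B`. The face of the polytope selected by `ω` is thus the
intersection of the faces selected by the members of its chain. If these are flats, so are the
members of the chain of any other vector in the normal cone of that face: for an admissible set `G`
that is not a flat every maximizing `B` spans `G` and avoids `G*`, whereas, the sets `{a | c < ±ω}`
being flats, every `x` at which `±ω` is nonnegative lies in some maximizing `B`, which contradicts
this for a suitable `x` in `G*` or in the closure of `G`. So the normal cones of the vectors of the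
Bergman fan do not leave its support, and they form the desired subfan.
-/

section Superlevels

open Function

variable {α : Type*}

theorem subset_of_isChain_of_ncard_le [Finite α] {𝓖 : Set (Set α)} (h𝓖 : IsChain (· ⊆ ·) 𝓖)
    {G H : Set α} (hH : H ∈ 𝓖) (hG : G ∈ 𝓖) (h : H.ncard ≤ G.ncard) : H ⊆ G :=
  (h𝓖.total hH hG).elim id fun hGH => (Set.eq_of_subset_of_ncard_le hGH h).ge

/-- The nonempty superlevel sets `{a | t ≤ f a}`, `t > 0`, of a function. -/
def superlevels (f : α → ℝ) : Set (Set α) :=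
  {G | G.Nonempty ∧ ∃ t > 0, {a | t ≤ f a} = G}

theorem isChain_superlevels (f : α → ℝ) : IsChain (· ⊆ ·) (superlevels f) := by
  rintro _ ⟨-, s, -, rfl⟩ _ ⟨-, t, -, rfl⟩ -
  exact (le_total t s).imp (fun h _ ha => h.trans ha) fun h _ ha => h.trans ha

theorem superlevels_congr {f g : α → ℝ} (h : ∀ t > 0, ∀ a, t ≤ f a ↔ t ≤ g a) :
    superlevels f = superlevels g := by
  ext G
  refine and_congr_right fun _ => exists_congr fun t => and_congr_right fun ht => ?_
  rw [show {a | t ≤ f a} = {a | t ≤ g a} from Set.ext (h t ht)]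

theorem superlevels_zero : superlevels (0 : α → ℝ) = ∅ := by
  rw [Set.eq_empty_iff_forall_notMem]
  rintro _ ⟨⟨a, ha⟩, t, ht, rfl⟩
  exact ha.not_gt ht

theorem superlevels_smul {c : ℝ} (hc : 0 < c) (f : α → ℝ) :
    superlevels (c • f) = superlevels f := by
  have key : ∀ c : ℝ, 0 < c → ∀ f : α → ℝ, superlevels f ⊆ superlevels (c • f) := by
    rintro c hc f _ ⟨hne, t, ht, rfl⟩
    exact ⟨hne, c * t, mul_pos hc ht, by simp [mul_le_mul_iff_right₀ hc]⟩
  refine subset_antisymm ?_ (key c hc f)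
  simpa only [inv_smul_smul₀ hc.ne'] using key c⁻¹ (inv_pos.2 hc) (c • f)

theorem superlevels_indicator_add {g : α → ℝ} {G : Set α} {ε : ℝ} (hg : 0 ≤ g) (hG : G.Nonempty)
    (hgG : support g ⊆ G) (hε : 0 < ε) :
    superlevels (ε • G.indicator 1 + g) = insert G (superlevels g) := by
  set f := ε • G.indicator 1 + g with hf
  have hf_mem : ∀ a ∈ G, f a = ε + g a := fun a ha => by simp [hf, ha]
  have hg_notMem : ∀ a ∉ G, g a = 0 := fun a ha => notMem_support.1 fun h => ha (hgG h)
  have hf_notMem : ∀ a ∉ G, f a = 0 := fun a ha => by simp [hf, ha, hg_notMem a ha]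
  have hlow : ∀ t > 0, t ≤ ε → {a | t ≤ f a} = G := fun t ht hε => by
    ext a
    by_cases ha : a ∈ G
    · simpa [ha, hf_mem a ha] using hε.trans (le_add_of_nonneg_right (hg a))
    · simpa [ha, hf_notMem a ha] using ht
  have hhigh : ∀ t > ε, {a | t ≤ f a} = {a | t - ε ≤ g a} := fun t ht => by
    ext a
    by_cases ha : a ∈ G
    · simp [hf_mem a ha, add_comm]
    · simpa [hf_notMem a ha, hg_notMem a ha, (hε.trans ht).not_ge] using ht
  ext H
  constructor
  · rintro ⟨hne, t, ht, rfl⟩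
    rcases le_or_gt t ε with h | h
    · exact Or.inl (hlow t ht h)
    · exact Or.inr ⟨hne, t - ε, sub_pos.2 h, (hhigh t h).symm⟩
  · rintro (rfl | ⟨hne, t, ht, rfl⟩)
    · exact ⟨hG, ε, hε, hlow ε hε le_rfl⟩
    · exact ⟨hne, ε + t, by positivity, by simp [hhigh (ε + t) (by linarith)]⟩

theorem superlevels_indicator_subset (G : Set α) : superlevels (G.indicator 1) ⊆ {G} := by
  rcases G.eq_empty_or_nonempty with rfl | hG
  · rw [Set.indicator_empty', superlevels_zero]
    exact Set.empty_subset _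
  · have h := superlevels_indicator_add le_rfl hG (by simp) one_pos
    rw [one_smul, add_zero, superlevels_zero] at h
    simp [h]

theorem setOf_lt_mem_superlevels [Finite α] {f : α → ℝ} {c : ℝ} (hc : 0 ≤ c)
    (hne : {a | c < f a}.Nonempty) : {a | c < f a} ∈ superlevels f := by
  obtain ⟨m, hm, hmin⟩ := Set.exists_min_image _ f (Set.toFinite _) hne
  have hcm : c < f m := hm
  exact ⟨hne, f m, hc.trans_lt hcm, Set.ext fun a => ⟨fun ha => hcm.trans_le ha, hmin a⟩⟩

theorem exists_eq_sum_superlevels [Fintype α] {f : α → ℝ} (hf : 0 ≤ f) :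
    ∃ c : Set α → ℝ, 0 ≤ c ∧ support c = superlevels f ∧ f = ∑ G, c G • G.indicator 1 := by
  classical
  induction hk : (support f).ncard using Nat.strong_induction_on generalizing f with
  | _ k ih =>
  by_cases hf0 : f = 0
  · exact ⟨0, le_rfl, by simp [hf0, superlevels_zero], by simp [hf0]⟩
  have hne : (support f).Nonempty := support_nonempty_iff.2 hf0
  obtain ⟨m, hm, hmin⟩ := Set.exists_min_image _ f (support f).toFinite hne
  have hm0 : 0 < f m := (hf m).lt_of_ne' hm
  set g := f - f m • (support f).indicator 1 with hg_def
  have hg : 0 ≤ g := fun a => by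
    by_cases ha : a ∈ support f
    · simpa [hg_def, Set.indicator_of_mem ha] using hmin a ha
    · simp [hg_def, notMem_support.1 ha]
  have hgf : support g ⊆ support f := fun a ha => by
    contrapose! ha
    simp [hg_def, notMem_support.1 ha]
  have hgm : m ∉ support g := by simp [hg_def, Set.indicator_of_mem hm]
  have hfg : f m • (support f).indicator 1 + g = f := add_sub_cancel _ _
  obtain ⟨c, hc, hcg, hgc⟩ :=
    ih _ (hk ▸ Set.ncard_lt_ncard ((Set.ssubset_iff_of_subset hgf).2 ⟨m, hm, hgm⟩)) hg rfl
  refine ⟨Pi.single (support f) (f m) + c, add_nonneg (Pi.single_nonneg.2 hm0.le) hc, ?_, ?_⟩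
  · conv_rhs => rw [← hfg, superlevels_indicator_add hg hne hgf hm0, ← hcg]
    ext G
    rcases eq_or_ne G (support f) with rfl | hG
    · simpa using (add_pos_of_pos_of_nonneg hm0 (hc (support f))).ne'
    · simp [hG]
  · simp only [Pi.add_apply, add_smul, Finset.sum_add_distrib, ← hgc]
    simpa [Pi.single_apply, ite_smul] using hfg.symm

theorem superlevels_sum_finset [Finite α] {s : Finset (Set α)} {c : Set α → ℝ}
    (hs : IsChain (· ⊆ ·) (s : Set (Set α))) (hne : ∀ G ∈ s, G.Nonempty) (hc : ∀ G ∈ s, 0 < c G) :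
    superlevels (∑ G ∈ s, c G • G.indicator 1) = s := by
  classical
  induction s using Finset.induction_on_max_value (fun G : Set α => G.ncard) with
  | empty => simp [superlevels_zero]
  | insert G s hGs hmax ih =>
    rw [Finset.coe_insert] at hs
    rw [Finset.forall_mem_insert] at hne hc
    have hsub : ∀ H ∈ s, H ⊆ G := fun H hH =>
      subset_of_isChain_of_ncard_le hs (Or.inr hH) (Or.inl rfl) (hmax H hH)
    have hsupp : support (∑ H ∈ s, c H • H.indicator (1 : α → ℝ)) ⊆ G := fun a ha => by
      rw [mem_support, Finset.sum_apply] at ha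
      obtain ⟨H, hH, hHa⟩ := Finset.exists_ne_zero_of_sum_ne_zero ha
      exact hsub H hH (Set.mem_of_indicator_ne_zero (right_ne_zero_of_mul hHa))
    rw [Finset.sum_insert hGs, superlevels_indicator_add _ hne.1 hsupp hc.1,
      ih (hs.mono (Set.subset_insert _ _)) hne.2 hc.2, Finset.coe_insert]
    exact Finset.sum_nonneg fun H hH =>
      smul_nonneg (hc.2 H hH).le (Set.indicator_nonneg fun _ _ => zero_le_one)

theorem superlevels_sum [Fintype α] {c : Set α → ℝ} (hc : 0 ≤ c)
    (hchain : IsChain (· ⊆ ·) (support c))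
    (hne : ∀ G ∈ support c, G.Nonempty) :
    superlevels (∑ G, c G • G.indicator 1) = support c := by
  classical
  have hsum : ∑ G, c G • G.indicator (1 : α → ℝ) = ∑ G with c G ≠ 0, c G • G.indicator 1 := by
    rw [Finset.sum_filter_of_ne]
    exact fun G _ h => left_ne_zero_of_smul h
  have hcoe : ((Finset.univ.filter fun G => c G ≠ 0 : Finset (Set α)) : Set (Set α)) =
      support c := by
    ext G
    simp
  rw [hsum, superlevels_sum_finset (hcoe ▸ hchain) (fun G hG => hne G (by simpa using hG))
    fun G hG => (hc G).lt_of_ne' (by simpa using hG), hcoe]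

end Superlevels

section SignedVectors

open Function

variable {n : ℕ}

theorem AdmissibleSet.mono {A B : Set (SignedGround n)} (hB : AdmissibleSet B) (h : A ⊆ B) :
    AdmissibleSet A :=
  fun a ha ha' => hB a (h ha) (h ha')

theorem AdmissibleSet.sUnion {𝓖 : Set (Set (SignedGround n))} (h𝓖 : IsChain (· ⊆ ·) 𝓖)
    (ha : ∀ G ∈ 𝓖, AdmissibleSet G) : AdmissibleSet (⋃₀ 𝓖) := by
  rintro a ⟨G, hG, haG⟩ ⟨G', hG', haG'⟩
  rcases h𝓖.total hG hG' with h | h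
  · exact ha G' hG' a (h haG) haG'
  · exact ha G hG a haG (h haG')

/-- The extension of `ω`, a function on `[n]`, to an odd function on `[n] ⊔ [n]*`: its value at
`a` is the scalar product of `ω` with the signed unit vector of `a`. -/
def oddExt (ω : Fin n → ℝ) : SignedGround n → ℝ := Sum.elim ω (-ω)

theorem oddExt_swap (ω : Fin n → ℝ) (a : SignedGround n) : oddExt ω a.swap = -oddExt ω a := by
  cases a <;> simp [oddExt]

/-- The nonempty sets `{a | t ≤ oddExt ω a}`, `t > 0`. They form the chain of admissible sets whose
cone contains `ω` in its relative interior. -/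
def levels (ω : Fin n → ℝ) : Set (Set (SignedGround n)) := superlevels (oddExt ω)

theorem isChain_levels (ω : Fin n → ℝ) : IsChain (· ⊆ ·) (levels ω) :=
  isChain_superlevels _

theorem admissibleSet_of_mem_levels {ω : Fin n → ℝ} {G : Set (SignedGround n)}
    (hG : G ∈ levels ω) : AdmissibleSet G := by
  obtain ⟨-, t, ht, rfl⟩ := hG
  intro a (ha : t ≤ oddExt ω a) (ha' : t ≤ oddExt ω a.swap)
  rw [oddExt_swap] at ha'
  linarith

theorem signedVec_eq_indicator (A : Set (SignedGround n)) (i : Fin n) :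
    signedVec A i = A.indicator 1 (Sum.inl i) - A.indicator 1 (Sum.inr i) := by
  classical
  simp only [signedVec, Set.indicator_apply, Pi.one_apply]

theorem oddExt_signedVec (A : Set (SignedGround n)) (a : SignedGround n) :
    oddExt (signedVec A) a = A.indicator 1 a - A.indicator 1 a.swap := by
  cases a <;> simp [oddExt, signedVec_eq_indicator]

theorem exists_eq_sum_levels (ω : Fin n → ℝ) :
    ∃ c : Set (SignedGround n) → ℝ, 0 ≤ c ∧ support c = levels ω ∧ ω = ∑ G, c G • signedVec G := by
  obtain ⟨c, hc, hsupp, hsum⟩ := exists_eq_sum_superlevels (f := (oddExt ω)⁺) (posPart_nonneg _)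
  refine ⟨c, hc, hsupp.trans (superlevels_congr fun t ht a => ?_), funext fun i => ?_⟩
  · simp [posPart_def, ht.not_ge]
  · calc ω i = (oddExt ω)⁺ (Sum.inl i) - (oddExt ω)⁺ (Sum.inr i) := by
          simp [oddExt]
      _ = (∑ G, c G • signedVec G) i := by
          rw [hsum]
          simp [signedVec_eq_indicator, mul_sub]

theorem levels_sum {c : Set (SignedGround n) → ℝ} (hc : 0 ≤ c)
    (hchain : IsChain (· ⊆ ·) (support c)) (hne : ∀ G ∈ support c, G.Nonempty)
    (hadm : ∀ G ∈ support c, AdmissibleSet G) : levels (∑ G, c G • signedVec G) = support c := by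
  rw [← superlevels_sum hc hchain hne]
  refine superlevels_congr fun t ht a => ?_
  set F : SignedGround n → ℝ := ∑ G, c G • G.indicator 1 with hF
  have hF0 : 0 ≤ F := Finset.sum_nonneg fun G _ =>
    smul_nonneg (hc G) (Set.indicator_nonneg fun _ _ => zero_le_one)
  have hodd : oddExt (∑ G, c G • signedVec G) a = F a - F a.swap := by
    have (i : Fin n) : (∑ G, c G • signedVec G) i = F (Sum.inl i) - F (Sum.inr i) := by
      simp [hF, signedVec_eq_indicator, mul_sub]
    cases a <;> simp [oddExt, this]
  have hmem : ∀ b, F b ≠ 0 → b ∈ ⋃₀ support c := fun b hb => by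
    rw [hF, Finset.sum_apply] at hb
    obtain ⟨G, -, hG⟩ := Finset.exists_ne_zero_of_sum_ne_zero hb
    exact ⟨G, left_ne_zero_of_mul hG, Set.mem_of_indicator_ne_zero (right_ne_zero_of_mul hG)⟩
  have hdisj : F a = 0 ∨ F a.swap = 0 := by
    by_contra! h
    exact AdmissibleSet.sUnion hchain hadm a (hmem _ h.1) (hmem _ h.2)
  rw [hodd]
  rcases hdisj with h | h
  · have := hF0 a.swap
    rw [h]
    constructor <;> intro h' <;> simp at this <;> linarith
  · rw [h, sub_zero]

theorem levels_add {x y : Fin n → ℝ} (h : IsChain (· ⊆ ·) (levels x ∪ levels y)) :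
    levels (x + y) = levels x ∪ levels y := by
  obtain ⟨c, hc, hcx, hx⟩ := exists_eq_sum_levels x
  obtain ⟨d, hd, hdy, hy⟩ := exists_eq_sum_levels y
  have hsupp : support (c + d) = levels x ∪ levels y := by
    rw [← hcx, ← hdy]
    ext G
    have hcG := hc G
    have hdG := hd G
    simp only [mem_support, Pi.add_apply, Set.mem_union, ne_eq, Pi.zero_apply] at *
    rw [add_eq_zero_iff_of_nonneg hcG hdG, not_and_or]
  have hsum : x + y = ∑ G, (c + d) G • signedVec G := by
    simp only [Pi.add_apply, add_smul, Finset.sum_add_distrib]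
    rw [← hx, ← hy]
  rw [hsum, levels_sum (add_nonneg hc hd), hsupp]
  · rwa [hsupp]
  · rw [hsupp]
    rintro G (hG | hG) <;> exact hG.1
  · rw [hsupp]
    rintro G (hG | hG) <;> exact admissibleSet_of_mem_levels hG

theorem levels_smul {a : ℝ} (ha : 0 < a) (ω : Fin n → ℝ) : levels (a • ω) = levels ω := by
  have : oddExt (a • ω) = a • oddExt ω := funext fun b => by cases b <;> simp [oddExt]
  rw [levels, this, superlevels_smul ha, levels]

theorem levels_zero : levels (0 : Fin n → ℝ) = ∅ := by
  have : oddExt (0 : Fin n → ℝ) = 0 := funext fun a => by cases a <;> simp [oddExt]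
  rw [levels, this, superlevels_zero]

theorem levels_signedVec_subset {A : Set (SignedGround n)} (hA : AdmissibleSet A) :
    levels (signedVec A) ⊆ {A} := by
  refine (superlevels_congr fun t ht a => ?_).trans_subset (superlevels_indicator_subset A)
  rw [oddExt_signedVec]
  by_cases ha : a ∈ A
  · simp [Set.indicator_of_notMem (hA a ha)]
  · have : 0 ≤ A.indicator (1 : SignedGround n → ℝ) a.swap :=
      Set.indicator_nonneg (fun _ _ => zero_le_one) _
    rw [Set.indicator_of_notMem ha]
    constructor <;> intro <;> linarith

theorem mem_hull_iff_levels_subset {𝓕 : Set (Set (SignedGround n))} (h𝓕 : IsChain (· ⊆ ·) 𝓕)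
    (ha : ∀ F ∈ 𝓕, AdmissibleSet F) {ω : Fin n → ℝ} :
    ω ∈ PointedCone.hull ℝ (signedVec '' 𝓕) ↔ levels ω ⊆ 𝓕 := by
  constructor
  · intro h
    induction h using Submodule.span_induction with
    | mem x hx =>
      obtain ⟨F, hF, rfl⟩ := hx
      exact (levels_signedVec_subset (ha F hF)).trans (Set.singleton_subset_iff.2 hF)
    | zero => simp [levels_zero]
    | add x y _ _ hx hy =>
      rw [levels_add (h𝓕.mono (Set.union_subset hx hy))]
      exact Set.union_subset hx hy
    | smul a x _ hx =>
      rcases eq_or_lt_of_le a.2 with h | h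
      · obtain rfl : a = 0 := Subtype.ext h.symm
        simp [levels_zero]
      · exact (levels_smul h x).trans_subset hx
  · intro h
    obtain ⟨c, hc, hcω, hω⟩ := exists_eq_sum_levels ω
    rw [hω]
    refine Submodule.sum_mem _ fun G _ => ?_
    by_cases hG : c G = 0
    · simp [hG]
    · exact PointedCone.smul_mem _ (hc G)
        (PointedCone.subset_hull (Set.mem_image_of_mem _ (h (hcω ▸ hG))))

end SignedVectors

section NormalCones

variable {n : ℕ} {V : Set (Fin n → ℝ)} {ω ν μ : Fin n → ℝ}

theorem mem_normalCone : ν ∈ normalCone V ω ↔ maxFace V ω ⊆ maxFace V ν := Iff.rfl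

theorem self_mem_normalCone (V : Set (Fin n → ℝ)) (ω : Fin n → ℝ) : ω ∈ normalCone V ω :=
  mem_normalCone.2 subset_rfl

theorem dotProduct_le_of_mem_convexHull {c : ℝ} (h : ∀ y ∈ V, y ⬝ᵥ ω ≤ c) {x : Fin n → ℝ}
    (hx : x ∈ convexHull ℝ V) : x ⬝ᵥ ω ≤ c :=
  convexHull_min h (convex_halfSpace_le ⟨fun x y => add_dotProduct x y ω,
    fun a x => smul_dotProduct a x ω⟩ c) hx

theorem normalCone_convexHull (V : Set (Fin n → ℝ)) :
    normalCone (convexHull ℝ V) = normalCone V := by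
  ext ω ν
  have hV := subset_convexHull ℝ V
  constructor
  · intro h x hx
    have hx' : x ∈ maxFace (convexHull ℝ V) ω :=
      ⟨hV hx.1, fun y hy => dotProduct_le_of_mem_convexHull hx.2 hy⟩
    exact ⟨hx.1, fun y hy => (h hx').2 y (hV hy)⟩
  · intro h x hx
    refine ⟨hx.1, fun y hy => dotProduct_le_of_mem_convexHull (fun y hy => ?_) hy⟩
    obtain ⟨ι, _, w, z, hw, hw1, hz, hx_eq⟩ := mem_convexHull_iff_exists_fintype.1 hx.1
    have hdot : ∀ μ, x ⬝ᵥ μ = ∑ i, w i * (z i ⬝ᵥ μ) := fun μ => by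
      simp only [← hx_eq, sum_dotProduct, smul_dotProduct, smul_eq_mul]
    have hzmax : ∀ i, w i ≠ 0 → z i ∈ maxFace V ω := by
      have hsum : ∑ i, w i * (x ⬝ᵥ ω - z i ⬝ᵥ ω) = 0 := by
        simp only [mul_sub, Finset.sum_sub_distrib, ← Finset.sum_mul, hw1, one_mul, ← hdot,
          sub_self]
      have hterm := (Finset.sum_eq_zero_iff_of_nonneg fun i _ =>
        mul_nonneg (hw i) (sub_nonneg.2 (hx.2 _ (hV (hz i))))).1 hsum
      intro i hi
      have hi' := (mul_eq_zero.1 (hterm i (Finset.mem_univ i))).resolve_left hi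
      exact ⟨hz i, fun y hy => (hx.2 y (hV hy)).trans (sub_eq_zero.1 hi').le⟩
    calc y ⬝ᵥ ν = ∑ i, w i * (y ⬝ᵥ ν) := by rw [← Finset.sum_mul, hw1, one_mul]
      _ ≤ ∑ i, w i * (z i ⬝ᵥ ν) := Finset.sum_le_sum fun i _ => by
          by_cases hi : w i = 0
          · simp [hi]
          · exact mul_le_mul_of_nonneg_left ((h (hzmax i hi)).2 y hy) (hw i)
      _ = x ⬝ᵥ ν := (hdot ν).symm

theorem maxFace_zero (V : Set (Fin n → ℝ)) : maxFace V 0 = V := by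
  simp [maxFace]

theorem maxFace_smul_add {a : ℝ} (ha : 0 < a) (h : (maxFace V ω ∩ maxFace V ν).Nonempty) :
    maxFace V (a • ω + ν) = maxFace V ω ∩ maxFace V ν := by
  obtain ⟨p, hpω, hpν⟩ := h
  simp only [maxFace, dotProduct_add, dotProduct_smul, smul_eq_mul]
  ext x
  constructor
  · rintro ⟨hx, hmax⟩
    have hp := hmax p hpω.1
    have hω := hpω.2 x hx
    have hν := hpν.2 x hx
    have haω := mul_le_mul_of_nonneg_left hω ha.le
    have hω' : p ⬝ᵥ ω ≤ x ⬝ᵥ ω := le_of_mul_le_mul_left (by linarith) ha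
    have hν' : p ⬝ᵥ ν ≤ x ⬝ᵥ ν := by linarith
    exact ⟨⟨hx, fun y hy => (hpω.2 y hy).trans hω'⟩, hx, fun y hy => (hpν.2 y hy).trans hν'⟩
  · rintro ⟨⟨hx, hω⟩, -, hν⟩
    exact ⟨hx, fun y hy => add_le_add (mul_le_mul_of_nonneg_left (hω y hy) ha.le) (hν y hy)⟩

theorem mem_maxFace_sum {ι : Type*} {s : Finset ι} {c : ι → ℝ} (hc : 0 ≤ c) {f : ι → Fin n → ℝ}
    {p : Fin n → ℝ} (hpV : p ∈ V) (hp : ∀ i ∈ s, c i ≠ 0 → p ∈ maxFace V (f i)) {x : Fin n → ℝ}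
    (hx : x ∈ V) :
    x ∈ maxFace V (∑ i ∈ s, c i • f i) ↔ ∀ i ∈ s, c i ≠ 0 → x ∈ maxFace V (f i) := by
  classical
  induction s using Finset.induction_on generalizing x with
  | empty => simp [maxFace_zero, hx]
  | insert i s his ih =>
    rw [Finset.forall_mem_insert] at hp ⊢
    rw [Finset.sum_insert his]
    by_cases hi : c i = 0
    · simp [hi, ih hp.2 hx]
    · rw [maxFace_smul_add ((hc i).lt_of_ne' hi) ⟨p, hp.1 hi, (ih hp.2 hpV).2 hp.2⟩,
        Set.mem_inter_iff, ih hp.2 hx]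
      simp [hi]

theorem finite_normalFan (hV : V.Finite) : (normalFan V).Finite := by
  have hfac : (normalCone V).FactorsThrough (maxFace V) :=
    fun ω ν h => SetLike.ext fun μ => by simp only [mem_normalCone, h]
  have hfin : (Set.range (maxFace V)).Finite :=
    hV.powerset.subset (Set.range_subset_iff.2 fun ω x hx => hx.1)
  rw [normalFan, ← hfac.extend_comp fun _ => ⊥, Set.range_comp]
  exact hfin.image _

theorem maxFace_nonempty (hV : V.Finite) (hne : V.Nonempty) (ω : Fin n → ℝ) :
    (maxFace V ω).Nonempty := by
  obtain ⟨x, hx, hmax⟩ := Set.exists_max_image V (· ⬝ᵥ ω) hV hne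
  exact ⟨x, hx, hmax⟩

theorem isFaceOf_inf_normalCone (hω : (maxFace V ω).Nonempty) (ω' : Fin n → ℝ) :
    (normalCone V ω ⊓ normalCone V ω').IsFaceOf (normalCone V ω) := by
  refine ⟨inf_le_left, fun {x y a} hx hy ha hxy => ⟨hx, ?_⟩⟩
  rw [SetLike.mem_coe, mem_normalCone] at *
  have h := mem_normalCone.1 (Submodule.mem_inf.1 hxy).2
  rw [maxFace_smul_add ha (hω.mono (Set.subset_inter hx hy))] at h
  exact h.trans Set.inter_subset_left

theorem exists_smul_sub_mem_normalCone (hV : V.Finite) (hμ : μ ∈ normalCone V ν) :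
    ∃ C : ℝ, 0 < C ∧ C • ν - μ ∈ normalCone V ν := by
  rcases (maxFace V ν).eq_empty_or_nonempty with hempty | ⟨p, hp⟩
  · exact ⟨1, one_pos, by simp [mem_normalCone, hempty]⟩
  have hpμ := mem_normalCone.1 hμ hp
  have hlarge : ∀ y ∈ V, ∀ᶠ C : ℝ in Filter.atTop, p ⬝ᵥ μ - y ⬝ᵥ μ ≤ C * (p ⬝ᵥ ν - y ⬝ᵥ ν) := by
    intro y hy
    rcases (hp.2 y hy).lt_or_eq with hlt | heq
    · exact (Filter.tendsto_id.atTop_mul_const (sub_pos.2 hlt)).eventually_ge_atTop _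
    · have hy : y ∈ maxFace V ν := ⟨hy, heq ▸ hp.2⟩
      simp [heq, (mem_normalCone.1 hμ hy).2 p hp.1]
  obtain ⟨C, hC, hC0⟩ := (((Filter.eventually_all_finite hV).2 hlarge).and
    (Filter.eventually_gt_atTop 0)).exists
  refine ⟨C, hC0, fun x hx => ⟨hx.1, fun y hy => ?_⟩⟩
  have hxν : x ⬝ᵥ ν = p ⬝ᵥ ν := le_antisymm (hp.2 x hx.1) (hx.2 p hp.1)
  have hxμ : x ⬝ᵥ μ = p ⬝ᵥ μ :=
    le_antisymm (hpμ.2 x hx.1) ((mem_normalCone.1 hμ hx).2 p hp.1)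
  simp only [dotProduct_sub, dotProduct_smul, smul_eq_mul, hxν, hxμ]
  linarith [hC y hy]

theorem exists_eq_normalCone_of_isFaceOf (hV : V.Finite) (hω : (maxFace V ω).Nonempty)
    {τ : PointedCone ℝ (Fin n → ℝ)} (hτ : τ.IsFaceOf (normalCone V ω)) :
    ∃ ν ∈ τ, τ = normalCone V ν := by
  have hfin : (maxFace V '' τ).Finite :=
    hV.powerset.subset (Set.image_subset_iff.2 fun μ _ x hx => hx.1)
  obtain ⟨ν, hν, hmin⟩ := Set.Finite.exists_minimalFor' _ _ hfin ⟨0, τ.zero_mem⟩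
  refine ⟨ν, hν, le_antisymm (fun μ hμ => ?_) fun μ hμ => ?_⟩
  · have hinter := maxFace_smul_add one_pos (hω.mono (Set.subset_inter (hτ.le hν) (hτ.le hμ)))
    rw [one_smul] at hinter
    have h := hmin (τ.add_mem hν hμ) (hinter.trans_subset Set.inter_subset_left)
    exact (h.trans hinter.subset).trans Set.inter_subset_right
  · obtain ⟨C, hC, hmem⟩ := exists_smul_sub_mem_normalCone hV hμ
    have hle : normalCone V ν ≤ normalCone V ω := fun κ hκ =>
      mem_normalCone.2 ((mem_normalCone.1 (hτ.le hν)).trans (mem_normalCone.1 hκ))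
    refine hτ.mem_of_smul_add_mem (a := 1) (hle hμ) (hle hmem) one_pos ?_
    rw [one_smul, add_sub_cancel]
    exact τ.smul_mem hC.le hν

theorem isFan_image_normalCone (hV : V.Finite) (hne : V.Nonempty) {W : Set (Fin n → ℝ)}
    (hW : ∀ ω ∈ W, (normalCone V ω : Set (Fin n → ℝ)) ⊆ W) (hfg : ∀ ω ∈ W, (normalCone V ω).FG) :
    IsFan (normalCone V '' W) where
  finite := (finite_normalFan hV).subset (Set.image_subset_range _ _)
  fg := Set.forall_mem_image.2 hfg
  face_mem := by
    rintro _ ⟨ω, hω, rfl⟩ τ hτ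
    obtain ⟨ν, hν, rfl⟩ := exists_eq_normalCone_of_isFaceOf hV (maxFace_nonempty hV hne ω) hτ
    exact ⟨ν, hW ω hω (hτ.le hν), rfl⟩
  inter_face := by
    rintro _ ⟨ω, -, rfl⟩ _ ⟨ν, -, rfl⟩
    refine ⟨isFaceOf_inf_normalCone (maxFace_nonempty hV hne ω) ν, ?_⟩
    rw [inf_comm]
    exact isFaceOf_inf_normalCone (maxFace_nonempty hV hne ν) ω

theorem fanSupport_image_normalCone {W : Set (Fin n → ℝ)}
    (hW : ∀ ω ∈ W, (normalCone V ω : Set (Fin n → ℝ)) ⊆ W) :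
    fanSupport (normalCone V '' W) = W := by
  rw [fanSupport, Set.biUnion_image]
  exact subset_antisymm (Set.iUnion₂_subset hW) fun ω hω =>
    Set.mem_biUnion hω (self_mem_normalCone V ω)

end NormalCones

section Rank

variable {α : Type*} {M : Matroid α} {B G I X Y : Set α}

/-- The rank of a set in a matroid as a natural number, with junk value `0` where it is infinite. -/
noncomputable def natRk (M : Matroid α) (X : Set α) : ℕ := (M.eRk X).toNat

theorem natRk_closure (M : Matroid α) (X : Set α) : natRk M (M.closure X) = natRk M X := by
  rw [natRk, M.eRk_closure_eq, natRk]

theorem ncard_eq_natRk_of_isBasis (h : M.IsBasis I X) : I.ncard = natRk M X := by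
  rw [natRk, ← h.encard_eq_eRk, Set.ncard]

theorem ncard_eq_natRk_univ_of_isBase (h : M.IsBase B) : B.ncard = natRk M Set.univ := by
  rw [natRk, M.eRk_univ_eq, ← h.encard_eq_eRank, Set.ncard]

theorem isBasis_inter_of_subset (hG : M.IsBasis (I ∩ G) G) (hB : M.Indep B) (hIB : I ⊆ B) :
    M.IsBasis (B ∩ G) G :=
  (hB.subset Set.inter_subset_left).isBasis_of_subset_of_subset_closure Set.inter_subset_right
    (hG.subset_closure.trans (M.closure_subset_closure (Set.inter_subset_inter_left G hIB)))

theorem exists_mem_forall_mem_iff_eq_of_isChain {𝓗 : Set (Set α)} (h𝓗 : IsChain (· ⊆ ·) 𝓗)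
    {W : Set α} (hWfin : W.Finite) (hW : W.Nonempty) (hsub : ∀ H ∈ 𝓗, H ⊆ W) :
    ∃ y ∈ W, ∀ H ∈ 𝓗, y ∈ H ↔ H = W := by
  by_contra! h
  have hcover : ∀ y ∈ W, ∃ H ∈ 𝓗 \ {W}, y ∈ H := fun y hy => by
    obtain ⟨H, hH, ⟨hyH, hne⟩ | ⟨hyH, rfl⟩⟩ := h y hy
    · exact ⟨H, ⟨hH, hne⟩, hyH⟩
    · exact absurd hy hyH
  obtain ⟨y, hy⟩ := hW
  have hne : (𝓗 \ {W}).Nonempty := (hcover y hy).imp fun H hH => hH.1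
  obtain ⟨H, ⟨hH, hHW⟩, hWH⟩ := DirectedOn.exists_mem_subset_of_finite_of_subset_sUnion hne
    (h𝓗.mono Set.sdiff_subset).directedOn hWfin hcover
  exact hHW ((hsub H hH).antisymm hWH)

theorem exists_mem_sdiff_forall_mem_iff_of_isChain {𝓖 : Set (Set α)} (h𝓖 : IsChain (· ⊆ ·) 𝓖)
    {U : Set α} (hfin : (U \ I).Finite) (hne : (U \ I).Nonempty) (hsub : ∀ G ∈ 𝓖, G ⊆ U) :
    ∃ y ∈ U \ I, ∀ G ∈ 𝓖, y ∈ G ↔ G \ I = U \ I := by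
  obtain ⟨y, hy, h⟩ := exists_mem_forall_mem_iff_eq_of_isChain (𝓗 := (· \ I) '' 𝓖)
    (h𝓖.image_of_map_rel _ _ _ fun _ _ h => Set.sdiff_subset_sdiff_left h) hfin hne
    (Set.forall_mem_image.2 fun G hG => Set.sdiff_subset_sdiff_left (hsub G hG))
  exact ⟨y, hy, fun G hG => (and_iff_left hy.2).symm.trans (h _ (Set.mem_image_of_mem _ hG))⟩

variable [Finite α]

theorem coe_natRk (M : Matroid α) (X : Set α) : (natRk M X : ℕ∞) = M.eRk X :=
  ENat.natCast_toNat (M.isRkFinite_of_finite X.toFinite).eRk_lt_top.ne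

theorem natRk_mono (M : Matroid α) (h : X ⊆ Y) : natRk M X ≤ natRk M Y := by
  have := M.eRk_mono h
  rw [← coe_natRk, ← coe_natRk] at this
  exact_mod_cast this

theorem ncard_le_natRk (hI : M.Indep I) (hIX : I ⊆ X) : I.ncard ≤ natRk M X :=
  (ncard_eq_natRk_of_isBasis hI.isBasis_self).trans_le (natRk_mono M hIX)

theorem isBasis_of_natRk_le (hI : M.Indep I) (hIX : I ⊆ X) (h : natRk M X ≤ I.ncard)
    (hX : X ⊆ M.E) : M.IsBasis I X := by
  refine hI.isBasis_of_eRk_ge I.toFinite hIX ?_ hX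
  rw [← coe_natRk, hI.eRk_eq_encard, ← I.toFinite.cast_ncard_eq]
  exact_mod_cast h

theorem isBase_of_natRk_le (hI : M.Indep I) (h : natRk M Set.univ ≤ I.ncard) : M.IsBase I :=
  M.isBasis_ground_iff.1 <|
    isBasis_of_natRk_le hI hI.subset_ground ((natRk_mono M (Set.subset_univ _)).trans h) subset_rfl

theorem natRk_union_le (M : Matroid α) (X Y : Set α) : natRk M (X ∪ Y) ≤ natRk M X + Y.ncard := by
  have := M.eRk_union_le_eRk_add_encard X Y
  rw [← coe_natRk, ← coe_natRk, ← Y.toFinite.cast_ncard_eq] at this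
  exact_mod_cast this

theorem natRk_add_ncard_le (M : Matroid α) (h : X ⊆ Y) :
    natRk M Y + X.ncard ≤ natRk M X + Y.ncard := by
  have hunion := natRk_union_le M X (Y \ X)
  rw [Set.union_sdiff_cancel h] at hunion
  have := Set.ncard_sdiff_add_ncard_of_subset h
  lia

theorem exists_indep_isBasis_inter_of_isChain {s : Finset (Set α)}
    (hs : IsChain (· ⊆ ·) (s : Set (Set α))) (hE : ∀ G ∈ s, G ⊆ M.E) :
    ∃ I, M.Indep I ∧ ∀ G ∈ s, M.IsBasis (I ∩ G) G := by
  classical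
  induction s using Finset.induction_on_max_value (fun G : Set α => G.ncard) with
  | empty => exact ⟨∅, M.empty_indep, by simp⟩
  | insert G s _ hmax ih =>
    rw [Finset.coe_insert] at hs
    rw [Finset.forall_mem_insert] at hE
    obtain ⟨I, hI, hbasis⟩ := ih (hs.mono (Set.subset_insert _ _)) hE.2
    have hsub : ∀ H ∈ s, H ⊆ G := fun H hH =>
      subset_of_isChain_of_ncard_le hs (Or.inr hH) (Or.inl rfl) (hmax H hH)
    obtain ⟨J, hJ, hIJ⟩ := (hI.subset (Set.inter_subset_left (t := G))).subset_isBasis_of_subset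
      Set.inter_subset_right hE.1
    refine ⟨J, hJ.indep, Finset.forall_mem_insert _ _ _ |>.2 ⟨?_, fun H hH => ?_⟩⟩
    · rwa [Set.inter_eq_self_of_subset_left hJ.subset]
    · refine isBasis_inter_of_subset (I := I ∩ G) ?_ hJ.indep hIJ
      rw [Set.inter_assoc, Set.inter_eq_self_of_subset_right (hsub H hH)]
      exact hbasis H hH

end Rank

section AdmissibleSets

variable {n : ℕ} {A B T : Set (SignedGround n)} {x : SignedGround n}

theorem AdmissibleSet.insert (hA : AdmissibleSet A) (hx : x.swap ∉ A) :
    AdmissibleSet (insert x A) := by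
  have hne : x.swap ≠ x := by cases x <;> simp
  rintro a (rfl | ha) (h | h)
  · exact hne h
  · exact hx h
  · rw [← h, Sum.swap_swap] at hx
    exact hx ha
  · exact hA a ha h

theorem AdmissibleSet.union (hA : AdmissibleSet A) (hB : AdmissibleSet B)
    (h : ∀ a ∈ A, a.swap ∉ B) : AdmissibleSet (A ∪ B) := by
  rintro a (ha | ha) (h' | h')
  · exact hA a ha h'
  · exact h a ha h'
  · exact h _ h' (by simpa using ha)
  · exact hB a ha h'

theorem AdmissibleSet.ncard_le (hA : AdmissibleSet A) : A.ncard ≤ n := by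
  have hinj : Set.InjOn (Sum.elim id id) A := by
    rintro (i | i) hi (j | j) hj (rfl : i = j)
    · rfl
    · exact absurd hj (hA _ hi)
    · exact absurd hj (hA _ hi)
    · rfl
  simpa [hinj.ncard_image] using Set.ncard_le_card (Sum.elim id id '' A : Set (Fin n))

/-- `T` meets every pair `{a, a*}`. -/
def IsTransversal (T : Set (SignedGround n)) : Prop := ∀ a, a ∈ T ∨ a.swap ∈ T

theorem IsTransversal.le_ncard (hT : IsTransversal T) : n ≤ T.ncard := by
  have himage : Sum.elim id id '' T = (Set.univ : Set (Fin n)) :=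
    Set.eq_univ_of_forall fun i => (hT (Sum.inl i)).elim (fun h => ⟨_, h, rfl⟩) fun h => ⟨_, h, rfl⟩
  simpa [himage] using Set.ncard_image_le (f := Sum.elim id id) T.toFinite

theorem AdmissibleSet.exists_isTransversal (hA : AdmissibleSet A) :
    ∃ T, A ⊆ T ∧ AdmissibleSet T ∧ IsTransversal T := by
  refine ⟨A ∪ {a | a.isLeft ∧ a.swap ∉ A}, Set.subset_union_left, hA.union ?_ ?_, fun a => ?_⟩
  · rintro (i | i) ⟨h, -⟩ ⟨h', -⟩ <;> simp at h h'
  · rintro a ha ⟨-, h⟩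
    simp [ha] at h
  · by_cases ha : a ∈ A
    · exact Or.inl (Or.inl ha)
    by_cases ha' : a.swap ∈ A
    · exact Or.inr (Or.inl ha')
    rcases a with i | i
    · exact Or.inl (Or.inr ⟨rfl, ha'⟩)
    · exact Or.inr (Or.inr ⟨rfl, by simpa using ha⟩)

end AdmissibleSets

section AdmissibleMatroid

variable {n : ℕ} {M : Matroid (SignedGround n)} {A B G I K T U : Set (SignedGround n)}
  {a b y : SignedGround n}

theorem IsAdmissibleMatroid.subset_ground (hM : IsAdmissibleMatroid M) (A : Set (SignedGround n)) :
    A ⊆ M.E :=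
  hM.ground_eq ▸ A.subset_univ

theorem IsAdmissibleMatroid.subset_closure (hM : IsAdmissibleMatroid M)
    (A : Set (SignedGround n)) : A ⊆ M.closure A :=
  M.subset_closure A (hM.subset_ground A)

theorem IsAdmissibleMatroid.insert_indep_iff (hM : IsAdmissibleMatroid M) (hI : M.Indep I)
    (ha : a ∉ I) : M.Indep (insert a I) ↔ a ∉ M.closure I := by
  simp [hI.insert_indep_iff_of_notMem ha, hM.ground_eq]

theorem IsAdmissibleMatroid.swap_notMem_of_insert_mem_indepAd (hM : IsAdmissibleMatroid M)
    (h : insert a I ∈ indepAd M) : a.swap ∉ I := fun ha =>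
  h.2 a (hM.subset_closure _ (Set.mem_insert _ _))
    (hM.subset_closure _ (Set.mem_insert_of_mem _ ha))

theorem IsAdmissibleMatroid.exists_insert_insert_swap_eq (hM : IsAdmissibleMatroid M)
    (hK : M.Indep K) (hKa : ¬ AdmissibleSet K) :
    ∃ a I, AdmissibleSet I ∧ insert a (insert a.swap I) = K ∧
      insert a I ∈ indepAd M ∧ insert a.swap I ∈ indepAd M := by
  obtain ⟨I, hIK, -, hIa, hrank⟩ := (hM.rank_eq K).1
  rw [hK.eRk_eq_encard, rankContribution] at hrank
  split_ifs at hrank with h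
  · obtain ⟨a, ha, ha', h₁, h₂⟩ := h
    have ha₁ := hM.swap_notMem_of_insert_mem_indepAd h₁
    have ha₂ : a ∉ I := by simpa using hM.swap_notMem_of_insert_mem_indepAd h₂
    have hne : a ≠ a.swap := by cases a <;> simp
    refine ⟨a, I, hIa, Set.Finite.eq_of_subset_of_encard_le (Set.toFinite _) ?_ ?_, h₁, h₂⟩
    · exact Set.insert_subset ha (Set.insert_subset ha' hIK)
    · rw [hrank, Set.encard_insert_of_notMem (by simp [ha₂, hne]), Set.encard_insert_of_notMem ha₁,
        add_assoc, one_add_one_eq_two]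
  · rw [Set.Finite.eq_of_subset_of_encard_le (Set.toFinite _) hIK hrank.le] at hIa
    exact absurd hIa hKa

theorem IsAdmissibleMatroid.admissibleSet_closure_sdiff (hM : IsAdmissibleMatroid M)
    (hK : M.Indep K) (hb : b ∈ K) (hb' : b.swap ∈ K) :
    AdmissibleSet (M.closure (K \ {b.swap})) := by
  obtain ⟨a, I, hIa, rfl, h₁, h₂⟩ := hM.exists_insert_insert_swap_eq hK fun h => h b hb hb'
  have hba : b = a ∨ b = a.swap := by
    rcases hb with rfl | rfl | hbI
    · exact Or.inl rfl
    · exact Or.inr rfl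
    · rcases hb' with h | h | h
      · exact Or.inr (by rw [← h, Sum.swap_swap])
      · exact Or.inl (by simpa using congrArg Sum.swap h)
      · exact absurd h (hIa b hbI)
  rcases hba with rfl | rfl
  · refine h₁.2.mono (M.closure_subset_closure ?_)
    rw [Set.insert_comm, Set.insert_sdiff_of_mem _ (Set.mem_singleton _)]
    exact Set.sdiff_subset
  · refine h₂.2.mono (M.closure_subset_closure ?_)
    rw [Sum.swap_swap, Set.insert_sdiff_of_mem _ (Set.mem_singleton _)]
    exact Set.sdiff_subset

theorem IsAdmissibleMatroid.swap_mem_of_isFlat (hM : IsAdmissibleMatroid M) (hA : M.IsFlat A)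
    (hAa : ¬ AdmissibleSet A) (hb : b ∈ A) : b.swap ∈ A := by
  have := hM.loopless
  by_contra hb'
  have hb_indep : M.Indep {b} :=
    M.indep_singleton.2 (Matroid.isNonloop_of_loopless (hM.subset_ground _ (Set.mem_univ b)))
  obtain ⟨K, hK, hbK⟩ := hb_indep.subset_isBasis_of_subset (Set.singleton_subset_iff.2 hb)
  have hKA : M.closure K = A := by rw [hK.closure_eq_closure, hA.closure]
  have hbK' : b.swap ∉ K := fun h => hb' (hK.subset h)
  have hinsert : M.Indep (insert b.swap K) :=
    (hM.insert_indep_iff hK.indep hbK').2 (by rwa [hKA])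
  have hadm := hM.admissibleSet_closure_sdiff hinsert (Set.mem_insert_of_mem _ (hbK rfl))
    (Set.mem_insert _ _)
  rw [Set.insert_sdiff_of_mem _ (Set.mem_singleton _), Set.sdiff_singleton_eq_self hbK', hKA]
    at hadm
  exact hAa hadm

theorem IsAdmissibleMatroid.closure_eq_univ_of_isTransversal (hM : IsAdmissibleMatroid M)
    (hT : IsTransversal T) (hTa : ¬ AdmissibleSet (M.closure T)) : M.closure T = Set.univ :=
  Set.eq_univ_of_forall fun a => (hT a).elim (fun h => hM.subset_closure T h) fun h => by
    simpa using hM.swap_mem_of_isFlat (M.isFlat_closure T) hTa (hM.subset_closure T h)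

theorem IsAdmissibleMatroid.natRk_univ_le_of_isTransversal (hM : IsAdmissibleMatroid M)
    (hT : IsTransversal T) : natRk M Set.univ ≤ natRk M T + 1 := by
  by_cases h : M.closure T = Set.univ
  · rw [← h, natRk_closure]
    exact Nat.le_succ _
  · obtain ⟨x, hx⟩ := (Set.ne_univ_iff_exists_notMem _).1 h
    have hxT : x.swap ∈ T := (hT x).resolve_left fun h => hx (hM.subset_closure T h)
    have hinsert : IsTransversal (insert x T) := fun a => (hT a).imp Or.inr Or.inr
    have huniv := hM.closure_eq_univ_of_isTransversal hinsert fun h =>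
      h x (hM.subset_closure _ (Set.mem_insert _ _))
        (hM.subset_closure _ (Set.mem_insert_of_mem _ hxT))
    calc natRk M Set.univ = natRk M (T ∪ {x}) := by
          rw [← huniv, natRk_closure, Set.union_singleton]
      _ ≤ natRk M T + 1 := by simpa using natRk_union_le M T {x}

/-- The bound `r(J) + |U| - r(U) - n` on the number of elements of `U*` in an admissible base, for
admissible `U`, with truncated subtraction: it is `0` where this would be negative. The bound is
attained when there are admissible bases. -/
noncomputable def defect (M : Matroid (SignedGround n)) (U : Set (SignedGround n)) : ℕ :=
  natRk M Set.univ + U.ncard - (natRk M U + n)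

theorem defect_mono (M : Matroid (SignedGround n)) (h : G ⊆ U) : defect M G ≤ defect M U := by
  have := natRk_add_ncard_le M h
  unfold defect
  lia

theorem defect_le_ncard (hU : AdmissibleSet U) (hB : M.IsBase B) (hBa : AdmissibleSet B) :
    defect M U ≤ (B ∩ Sum.swap ⁻¹' U).ncard := by
  have hunion : AdmissibleSet (U ∪ B \ Sum.swap ⁻¹' U) :=
    hU.union (hBa.mono Set.sdiff_subset) fun a ha h => h.2 (by simpa using ha)
  have hle := hunion.ncard_le
  have hadd := Set.ncard_union_add_ncard_inter U (B \ Sum.swap ⁻¹' U)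
  have hinter : (U ∩ (B \ Sum.swap ⁻¹' U)).ncard ≤ natRk M U :=
    ncard_le_natRk (hB.indep.subset (Set.inter_subset_right.trans Set.sdiff_subset))
      Set.inter_subset_left
  have hsdiff := Set.ncard_inter_add_ncard_sdiff_eq_ncard B (Sum.swap ⁻¹' U)
  have hrank := ncard_eq_natRk_univ_of_isBase hB
  unfold defect
  lia

theorem IsAdmissibleMatroid.defect_le_one (hM : IsAdmissibleMatroid M) (hU : AdmissibleSet U) :
    defect M U ≤ 1 := by
  obtain ⟨T, hUT, hTa, hT⟩ := hU.exists_isTransversal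
  have hrank := hM.natRk_univ_le_of_isTransversal hT
  have hadd := natRk_add_ncard_le M hUT
  have hcard := hTa.ncard_le
  unfold defect
  lia

theorem IsAdmissibleMatroid.defect_eq_zero_of_not_isFlat (hM : IsAdmissibleMatroid M)
    (hU : AdmissibleSet U) (hUf : ¬ M.IsFlat U) : defect M U = 0 := by
  obtain ⟨x, hx, hxU⟩ : ∃ x ∈ M.closure U, x ∉ U := by
    by_contra! h
    exact hUf ((hM.subset_closure U).antisymm h ▸ M.isFlat_closure U)
  by_cases hxs : x.swap ∈ U
  · obtain ⟨T, hUT, hTa, hT⟩ := hU.exists_isTransversal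
    have huniv := hM.closure_eq_univ_of_isTransversal hT fun h =>
      h x (M.closure_subset_closure hUT hx) (hM.subset_closure T (hUT hxs))
    have hadd := natRk_add_ncard_le M hUT
    have hcard := hTa.ncard_le
    rw [← natRk_closure M T, huniv] at hadd
    unfold defect
    lia
  · have hle := hM.defect_le_one (hU.insert hxs)
    have hrank : natRk M (insert x U) ≤ natRk M U := by
      rw [← natRk_closure M U]
      exact natRk_mono M (Set.insert_subset hx (hM.subset_closure U))
    unfold defect at *
    rw [Set.ncard_insert_of_notMem hxU] at hle
    lia

theorem IsAdmissibleMatroid.isBase_of_maximal (hM : IsAdmissibleMatroid M)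
    (hI : M.IsBasis I U) (hdef : defect M U = 0) (hIB : I ⊆ B)
    (hB : Maximal (fun B => M.Indep B ∧ AdmissibleSet B ∧ ∀ u ∈ U, u.swap ∉ B) B) :
    M.IsBase B := by
  obtain ⟨hBi, hBa, hUB⟩ := hB.prop
  have hmax : ∀ x, x ∉ M.closure B → x.swap ∈ U ∪ B := by
    intro x hx
    by_contra hxUB
    obtain ⟨hxU, hxB⟩ : x.swap ∉ U ∧ x.swap ∉ B := by simpa using hxUB
    have hxB' : x ∉ B := fun h => hx (hM.subset_closure B h)
    refine hxB' (hB.le_of_ge ⟨(hM.insert_indep_iff hBi hxB').2 hx, hBa.insert hxB, ?_⟩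
      (Set.subset_insert _ _) (Set.mem_insert _ _))
    rintro u hu (rfl | h)
    · exact hxU (by simpa using hu)
    · exact hUB u hu h
  by_cases hcl : AdmissibleSet (M.closure B)
  · have htrans : IsTransversal (U ∪ B) := fun a => by
      by_cases ha : a ∈ M.closure B
      · exact Or.inl (by simpa using hmax a.swap (hcl a ha))
      · exact Or.inr (hmax a ha)
    have hle := htrans.le_ncard
    have hadd := Set.ncard_union_add_ncard_inter U B
    have hinter := Set.ncard_le_ncard (Set.subset_inter hI.subset hIB)
    rw [ncard_eq_natRk_of_isBasis hI] at hinter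
    unfold defect at hdef
    exact isBase_of_natRk_le hBi (by lia)
  · refine hBi.isBase_of_ground_subset_closure fun x _ => ?_
    by_contra hx
    have hx' : x.swap ∉ M.closure B := fun h =>
      hx (by simpa using hM.swap_mem_of_isFlat (M.isFlat_closure B) hcl h)
    rcases hmax x hx with h | h
    · exact hx' (M.closure_subset_closure hIB (hI.subset_closure h))
    · exact hx' (hM.subset_closure B h)

theorem IsAdmissibleMatroid.exists_isBase_disjoint (hM : IsAdmissibleMatroid M)
    (hU : AdmissibleSet U) (hI : M.IsBasis I U) (hdef : defect M U = 0) :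
    ∃ B, M.IsBase B ∧ AdmissibleSet B ∧ I ⊆ B ∧ B ∩ Sum.swap ⁻¹' U = ∅ := by
  obtain ⟨B, hIB, hB⟩ := Set.Finite.exists_le_maximal
    (s := {B | M.Indep B ∧ AdmissibleSet B ∧ ∀ u ∈ U, u.swap ∉ B}) (Set.toFinite _)
    ⟨hI.indep, hU.mono hI.subset, fun u hu h => hU u hu (hI.subset h)⟩
  refine ⟨B, hM.isBase_of_maximal hI hdef hIB hB, hB.prop.2.1, hIB, ?_⟩
  rw [Set.eq_empty_iff_forall_notMem]
  rintro z ⟨hzB, hzU⟩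
  exact hB.prop.2.2 _ hzU (by simpa using hzB)

theorem IsAdmissibleMatroid.exists_isBase_superset (hM : IsAdmissibleMatroid M)
    (hr : natRk M Set.univ ≤ n) (hI : M.Indep I) (hIa : AdmissibleSet I) :
    ∃ B, M.IsBase B ∧ AdmissibleSet B ∧ I ⊆ B := by
  have hdef : defect M I = 0 := by
    have := ncard_eq_natRk_of_isBasis hI.isBasis_self
    unfold defect
    lia
  obtain ⟨B, hB, hBa, hIB, -⟩ := hM.exists_isBase_disjoint hIa hI.isBasis_self hdef
  exact ⟨B, hB, hBa, hIB⟩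

theorem IsAdmissibleMatroid.inter_preimage_swap_eq_singleton (hM : IsAdmissibleMatroid M)
    (hU : AdmissibleSet U) (hI : M.IsBasis I U) (hy : y ∈ U) (hB : M.Indep B)
    (hIB : insert y.swap I ⊆ B) : B ∩ Sum.swap ⁻¹' U = {y.swap} := by
  set C := M.closure (insert y.swap I)
  have hUC : U ⊆ C := hI.subset_closure.trans (M.closure_subset_closure (Set.subset_insert _ _))
  have hCa : ¬ AdmissibleSet C := fun h =>
    h y (hUC hy) (hM.subset_closure _ (Set.mem_insert _ _))
  refine subset_antisymm ?_ (Set.singleton_subset_iff.2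
    ⟨hIB (Set.mem_insert _ _), by simpa using hy⟩)
  rintro z ⟨hzB, hzU⟩
  have hzC : z ∈ C := by
    simpa using hM.swap_mem_of_isFlat (M.isFlat_closure _) hCa (hUC hzU)
  have hz : z ∈ insert y.swap I := (hB.closure_inter_eq_self_of_subset hIB).subset ⟨hzC, hzB⟩
  exact hz.resolve_right fun h => hU z (hI.subset h) hzU

theorem IsAdmissibleMatroid.exists_isBase_inter_preimage_swap_eq_singleton
    (hM : IsAdmissibleMatroid M) (hr : natRk M Set.univ ≤ n) (hU : AdmissibleSet U)
    (hUf : M.IsFlat U) (hI : M.IsBasis I U) (hy : y ∈ U) (hyI : y ∉ I) :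
    ∃ B, M.IsBase B ∧ AdmissibleSet B ∧ I ⊆ B ∧ B ∩ Sum.swap ⁻¹' U = {y.swap} := by
  have hyU : y.swap ∉ U := hU y hy
  have hclosure : M.closure I = U := hI.closure_eq_closure.trans hUf.closure
  have hindep : M.Indep (insert y.swap I) :=
    (hM.insert_indep_iff hI.indep fun h => hyU (hI.subset h)).2 (by rwa [hclosure])
  have hadm : AdmissibleSet (insert y.swap I) :=
    (hU.mono hI.subset).insert (by simpa using hyI)
  obtain ⟨B, hB, hBa, hIB⟩ := hM.exists_isBase_superset hr hindep hadm
  exact ⟨B, hB, hBa, (Set.subset_insert _ _).trans hIB,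
    hM.inter_preimage_swap_eq_singleton hU hI hy hB.indep hIB⟩

theorem defect_eq_of_isBasis (hI : M.IsBasis (I ∩ G) G) :
    defect M G = natRk M Set.univ + (G \ I).ncard - n := by
  have := Set.ncard_inter_add_ncard_sdiff_eq_ncard G I
  rw [Set.inter_comm, ncard_eq_natRk_of_isBasis hI] at this
  unfold defect
  lia

theorem IsAdmissibleMatroid.exists_isBase_forall_ncard_eq_defect_of_pos
    (hM : IsAdmissibleMatroid M) (hr : natRk M Set.univ ≤ n)
    {𝓖 : Set (Set (SignedGround n))} (h𝓖 : IsChain (· ⊆ ·) 𝓖)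
    (hU : AdmissibleSet U) (hI : M.IsBasis I U) (hdef : 0 < defect M U)
    (hbasis : ∀ G ∈ 𝓖, G ⊆ U ∧ M.IsBasis (I ∩ G) G) :
    ∃ B, M.IsBase B ∧ AdmissibleSet B ∧ I ⊆ B ∧
      ∀ G ∈ 𝓖, (B ∩ Sum.swap ⁻¹' G).ncard = defect M G := by
  have hUf : M.IsFlat U := by
    by_contra h
    exact hdef.ne' (hM.defect_eq_zero_of_not_isFlat hU h)
  have hIU : I ∩ U = I := Set.inter_eq_left.2 hI.subset
  have hdefU : defect M U = natRk M Set.univ + (U \ I).ncard - n :=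
    defect_eq_of_isBasis (hIU.symm ▸ hI)
  have hone : defect M U = 1 := le_antisymm (hM.defect_le_one hU) hdef
  have hnonempty : (U \ I).Nonempty := by
    rw [Set.nonempty_iff_ne_empty]
    intro h
    rw [h, Set.ncard_empty] at hdefU
    lia
  -- The `G ∈ 𝓖` of defect one are those with `G \ I = U \ I`; `y` singles them out.
  obtain ⟨y, ⟨hyU, hyI⟩, hy⟩ := exists_mem_sdiff_forall_mem_iff_of_isChain h𝓖 (Set.toFinite _)
    hnonempty fun G hG => (hbasis G hG).1
  obtain ⟨B, hB, hBa, hIB, hBU⟩ :=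
    hM.exists_isBase_inter_preimage_swap_eq_singleton hr hU hUf hI hyU hyI
  refine ⟨B, hB, hBa, hIB, fun G hG => ?_⟩
  have hyB : y.swap ∈ B := (hBU.symm.subset rfl).1
  have hsub : B ∩ Sum.swap ⁻¹' G ⊆ {y.swap} :=
    hBU ▸ Set.inter_subset_inter_right B (Set.preimage_mono (hbasis G hG).1)
  have hdefG := defect_eq_of_isBasis (hbasis G hG).2
  by_cases hGU : G \ I = U \ I
  · have hBG : B ∩ Sum.swap ⁻¹' G = {y.swap} :=
      hsub.antisymm (Set.singleton_subset_iff.2 ⟨hyB, by simpa using (hy G hG).2 hGU⟩)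
    rw [hBG, Set.ncard_singleton, hdefG, hGU, ← hdefU, hone]
  · have hBG : B ∩ Sum.swap ⁻¹' G = ∅ := by
      refine Set.eq_empty_of_forall_notMem fun z hz => hGU ((hy G hG).1 ?_)
      simpa [Set.mem_singleton_iff.1 (hsub hz)] using hz.2
    have hlt := Set.ncard_lt_ncard
      ((Set.sdiff_subset_sdiff_left (hbasis G hG).1).ssubset_of_ne hGU)
    rw [hBG, Set.ncard_empty]
    lia

theorem IsAdmissibleMatroid.exists_isBase_forall_ncard_eq_defect (hM : IsAdmissibleMatroid M)
    (hr : natRk M Set.univ ≤ n) {𝓖 : Set (Set (SignedGround n))} (h𝓖 : IsChain (· ⊆ ·) 𝓖)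
    (hU : AdmissibleSet U) (hI : M.IsBasis I U)
    (hbasis : ∀ G ∈ 𝓖, G ⊆ U ∧ M.IsBasis (I ∩ G) G) :
    ∃ B, M.IsBase B ∧ AdmissibleSet B ∧ I ⊆ B ∧
      ∀ G ∈ 𝓖, (B ∩ Sum.swap ⁻¹' G).ncard = defect M G := by
  rcases Nat.eq_zero_or_pos (defect M U) with hdef | hdef
  · obtain ⟨B, hB, hBa, hIB, hBU⟩ := hM.exists_isBase_disjoint hU hI hdef
    refine ⟨B, hB, hBa, hIB, fun G hG => ?_⟩
    have hsub : B ∩ Sum.swap ⁻¹' G ⊆ ∅ :=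
      hBU ▸ Set.inter_subset_inter_right B (Set.preimage_mono (hbasis G hG).1)
    have := defect_mono M (hbasis G hG).1
    rw [Set.subset_empty_iff.1 hsub, Set.ncard_empty]
    lia
  · exact hM.exists_isBase_forall_ncard_eq_defect_of_pos hr h𝓖 hU hI hdef hbasis

theorem IsAdmissibleMatroid.exists_isBase_of_isChain (hM : IsAdmissibleMatroid M)
    (hr : natRk M Set.univ ≤ n) {𝓖 : Set (Set (SignedGround n))} (h𝓖 : IsChain (· ⊆ ·) 𝓖)
    (ha : ∀ G ∈ 𝓖, AdmissibleSet G) :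
    ∃ B, M.IsBase B ∧ AdmissibleSet B ∧
      ∀ G ∈ 𝓖, M.IsBasis (B ∩ G) G ∧ (B ∩ Sum.swap ⁻¹' G).ncard = defect M G := by
  have hchain : IsChain (· ⊆ ·) (insert (⋃₀ 𝓖) 𝓖) :=
    h𝓖.insert fun G hG _ => Or.inr (Set.subset_sUnion_of_mem hG)
  obtain ⟨I, -, hbasis⟩ := exists_indep_isBasis_inter_of_isChain (M := M)
    (s := (Set.toFinite (insert (⋃₀ 𝓖) 𝓖)).toFinset) (by simpa using hchain)
    fun G _ => hM.subset_ground G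
  simp only [Set.Finite.mem_toFinset] at hbasis
  have hbasis' : ∀ G ∈ 𝓖, G ⊆ ⋃₀ 𝓖 ∧ M.IsBasis (I ∩ ⋃₀ 𝓖 ∩ G) G := fun G hG => by
    have hGU := Set.subset_sUnion_of_mem hG
    rw [Set.inter_assoc, Set.inter_eq_right.2 hGU]
    exact ⟨hGU, hbasis G (Set.mem_insert_of_mem _ hG)⟩
  obtain ⟨B, hB, hBa, hIB, hdef⟩ := hM.exists_isBase_forall_ncard_eq_defect hr h𝓖
    (AdmissibleSet.sUnion h𝓖 ha) (hbasis _ (Set.mem_insert _ _)) hbasis'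
  exact ⟨B, hB, hBa, fun G hG =>
    ⟨isBasis_inter_of_subset (hbasis' G hG).2 hB.indep hIB, hdef G hG⟩⟩

end AdmissibleMatroid

section RankedSymplectic

open Function

variable {n : ℕ} {S : Set (Set (SignedGround n))} {M : Matroid (SignedGround n)}
  {B G : Set (SignedGround n)} {ω ν : Fin n → ℝ}

theorem IsRankedSymplectic.mem_iff (hS : IsRankedSymplectic S M) :
    B ∈ S ↔ M.IsBase B ∧ AdmissibleSet B := by
  rw [hS.bases_eq, Set.mem_ofPred_eq]

theorem IsRankedSymplectic.exists_mem_of_isChain (hS : IsRankedSymplectic S M)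
    {𝓖 : Set (Set (SignedGround n))} (h𝓖 : IsChain (· ⊆ ·) 𝓖) (ha : ∀ G ∈ 𝓖, AdmissibleSet G) :
    ∃ B ∈ S, ∀ G ∈ 𝓖, M.IsBasis (B ∩ G) G ∧ (B ∩ Sum.swap ⁻¹' G).ncard = defect M G := by
  obtain ⟨B₀, hB₀⟩ := hS.nonempty
  obtain ⟨hB₀, hB₀a⟩ := hS.mem_iff.1 hB₀
  have hr : natRk M Set.univ ≤ n := (ncard_eq_natRk_univ_of_isBase hB₀).symm.trans_le hB₀a.ncard_le
  obtain ⟨B, hB, hBa, h⟩ := hS.admissible.exists_isBase_of_isChain hr h𝓖 ha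
  exact ⟨B, hS.mem_iff.2 ⟨hB, hBa⟩, h⟩

theorem signedVec_dotProduct_signedVec (B G : Set (SignedGround n)) :
    signedVec B ⬝ᵥ signedVec G = (B ∩ G).ncard - (B ∩ Sum.swap ⁻¹' G).ncard := by
  have hncard : ∀ A : Set (SignedGround n), (A.ncard : ℝ) = ∑ a, A.indicator 1 a := fun A => by
    classical
    simp only [Set.indicator_apply, Pi.one_apply, Finset.sum_boole, Set.ncard_eq_toFinset_card',
      Set.filter_mem_univ_eq_toFinset]
  simp only [hncard, Fintype.sum_sum_type, Set.inter_indicator_one, Pi.mul_apply, dotProduct,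
    signedVec_eq_indicator, ← Finset.sum_add_distrib, ← Finset.sum_sub_distrib]
  refine Finset.sum_congr rfl fun i _ => ?_
  have hswap : ∀ a, (Sum.swap ⁻¹' G).indicator (1 : SignedGround n → ℝ) a =
      G.indicator 1 a.swap := fun a => rfl
  simp only [hswap, Sum.swap_inl, Sum.swap_inr]
  ring

theorem IsRankedSymplectic.signedVec_mem_maxFace_signedVec_iff (hS : IsRankedSymplectic S M)
    (hB : B ∈ S) (hG : AdmissibleSet G) :
    signedVec B ∈ maxFace (signedVec '' S) (signedVec G) ↔
      M.IsBasis (B ∩ G) G ∧ (B ∩ Sum.swap ⁻¹' G).ncard = defect M G := by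
  have hbound : ∀ B ∈ S, (B ∩ G).ncard ≤ natRk M G ∧
      defect M G ≤ (B ∩ Sum.swap ⁻¹' G).ncard := fun B hB => by
    obtain ⟨hB, hBa⟩ := hS.mem_iff.1 hB
    exact ⟨ncard_le_natRk (hB.indep.subset Set.inter_subset_left) Set.inter_subset_right,
      defect_le_ncard hG hB hBa⟩
  have hmem : signedVec B ∈ maxFace (signedVec '' S) (signedVec G) ↔ ∀ B' ∈ S,
      (B' ∩ G).ncard + (B ∩ Sum.swap ⁻¹' G).ncard ≤
        (B ∩ G).ncard + (B' ∩ Sum.swap ⁻¹' G).ncard := by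
    simp only [maxFace, Set.mem_ofPred_eq, Set.mem_image_of_mem _ hB, true_and,
      Set.forall_mem_image, signedVec_dotProduct_signedVec, sub_le_sub_iff]
    norm_cast
  rw [hmem]
  constructor
  · intro hmax
    obtain ⟨B', hB', h⟩ := hS.exists_mem_of_isChain (𝓖 := {G}) IsChain.singleton (by simpa using hG)
    obtain ⟨hbasis, hdef⟩ := h G rfl
    have hrank := ncard_eq_natRk_of_isBasis hbasis
    have hle := hmax B' hB'
    obtain ⟨hB₁, hB₂⟩ := hbound B hB
    exact ⟨isBasis_of_natRk_le ((hS.mem_iff.1 hB).1.indep.subset Set.inter_subset_left)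
      Set.inter_subset_right (by lia) (hS.admissible.subset_ground G), by lia⟩
  · rintro ⟨hbasis, hdef⟩ B' hB'
    have hrank := ncard_eq_natRk_of_isBasis hbasis
    have := hbound B' hB'
    lia

theorem IsRankedSymplectic.mem_maxFace_sum_iff (hS : IsRankedSymplectic S M)
    {c : Set (SignedGround n) → ℝ} (hc : 0 ≤ c) (hchain : IsChain (· ⊆ ·) (support c))
    (hadm : ∀ G ∈ support c, AdmissibleSet G) {x : Fin n → ℝ} (hx : x ∈ signedVec '' S) :
    x ∈ maxFace (signedVec '' S) (∑ G, c G • signedVec G) ↔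
      ∀ G ∈ support c, x ∈ maxFace (signedVec '' S) (signedVec G) := by
  obtain ⟨B, hB, h⟩ := hS.exists_mem_of_isChain hchain hadm
  have hmax : ∀ G ∈ support c, signedVec B ∈ maxFace (signedVec '' S) (signedVec G) := fun G hG =>
    (hS.signedVec_mem_maxFace_signedVec_iff hB (hadm G hG)).2 (h G hG)
  simpa using mem_maxFace_sum (s := Finset.univ) hc (Set.mem_image_of_mem _ hB)
    (fun G _ => hmax G) hx

theorem IsRankedSymplectic.mem_maxFace_iff_forall_levels (hS : IsRankedSymplectic S M)
    {x : Fin n → ℝ} (hx : x ∈ signedVec '' S) : x ∈ maxFace (signedVec '' S) ω ↔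
      ∀ G ∈ levels ω, x ∈ maxFace (signedVec '' S) (signedVec G) := by
  obtain ⟨c, hc, hcω, hω⟩ := exists_eq_sum_levels ω
  have h := hS.mem_maxFace_sum_iff hc (hcω ▸ isChain_levels ω)
    (fun G hG => admissibleSet_of_mem_levels (hcω ▸ hG)) hx
  rwa [← hω, hcω] at h

theorem IsRankedSymplectic.signedVec_mem_normalCone (hS : IsRankedSymplectic S M)
    (hG : G ∈ levels ω) : signedVec G ∈ normalCone (signedVec '' S) ω :=
  mem_normalCone.2 fun _ hx => (hS.mem_maxFace_iff_forall_levels hx.1).1 hx G hG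

theorem IsRankedSymplectic.normalCone_fg (hS : IsRankedSymplectic S M) (ω : Fin n → ℝ) :
    (normalCone (signedVec '' S) ω).FG := by
  have hspan : normalCone (signedVec '' S) ω =
      PointedCone.hull ℝ (signedVec '' {A | signedVec A ∈ normalCone (signedVec '' S) ω}) := by
    refine le_antisymm (fun ν hν => ?_) (Submodule.span_le.2 (Set.image_subset_iff.2 subset_rfl))
    have hlevels : levels ν ⊆ {A | signedVec A ∈ normalCone (signedVec '' S) ω} := fun G hG =>
      (mem_normalCone.1 hν).trans (mem_normalCone.1 (hS.signedVec_mem_normalCone hG))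
    exact Submodule.span_mono (Set.image_mono hlevels) <| (mem_hull_iff_levels_subset
      (isChain_levels ν) fun G hG => admissibleSet_of_mem_levels hG).2 subset_rfl
  rw [hspan]
  exact Submodule.fg_span (Set.toFinite _)

/-- The vectors all of whose positive superlevel sets are flats: the underlying set of the
Bergman fan. -/
def flatVectors (M : Matroid (SignedGround n)) : Set (Fin n → ℝ) :=
  {ω | ∀ G ∈ levels ω, M.IsFlat G}

theorem IsAdmissibleMatroid.isFlat_setOf_lt (hM : IsAdmissibleMatroid M) (hω : ω ∈ flatVectors M)
    {c : ℝ} (hc : 0 ≤ c) : M.IsFlat {a | c < oddExt ω a} := by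
  rcases Set.eq_empty_or_nonempty {a | c < oddExt ω a} with h | h
  · have := hM.loopless
    rw [h, ← M.loops_eq_empty]
    exact M.isFlat_closure ∅
  · exact hω _ (setOf_lt_mem_superlevels hc h)

theorem isChain_insert_insert_levels (ω : Fin n → ℝ) (x : SignedGround n) :
    IsChain (· ⊆ ·) (insert (insert x {a | oddExt ω x < oddExt ω a}) (levels ω)) := by
  refine (isChain_levels ω).insert ?_
  rintro _ ⟨-, t, -, rfl⟩ -
  rcases le_or_gt t (oddExt ω x) with h | h
  · exact Or.inl (Set.insert_subset h fun a ha => h.trans (le_of_lt ha))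
  · exact Or.inr fun a ha => Or.inr (h.trans_le ha)

theorem IsRankedSymplectic.exists_mem_maxFace_of_nonneg (hS : IsRankedSymplectic S M)
    (hω : ω ∈ flatVectors M) {x : SignedGround n} (hx : 0 ≤ oddExt ω x) :
    ∃ B ∈ S, signedVec B ∈ maxFace (signedVec '' S) ω ∧ x ∈ B := by
  set A : Set (SignedGround n) := {a | oddExt ω x < oddExt ω a}
  have hAa : AdmissibleSet (insert x A) := by
    refine AdmissibleSet.insert (fun a ha ha' => ?_) fun h => ?_
    · have ha : oddExt ω x < oddExt ω a := ha
      have ha' : oddExt ω x < oddExt ω a.swap := ha'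
      rw [oddExt_swap] at ha'
      linarith
    · have h : oddExt ω x < oddExt ω x.swap := h
      rw [oddExt_swap] at h
      linarith
  obtain ⟨B, hB, h⟩ := hS.exists_mem_of_isChain (isChain_insert_insert_levels ω x)
    (Set.forall_mem_insert.2 ⟨hAa, fun G hG => admissibleSet_of_mem_levels hG⟩)
  rw [Set.forall_mem_insert] at h
  refine ⟨B, hB, (hS.mem_maxFace_iff_forall_levels (Set.mem_image_of_mem _ hB)).2 fun G hG =>
    (hS.signedVec_mem_maxFace_signedVec_iff hB (admissibleSet_of_mem_levels hG)).2 (h.2 G hG), ?_⟩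
  by_contra hxB
  have hbasis := h.1.1
  rw [Set.inter_insert_of_notMem hxB] at hbasis
  have hxA : x ∈ M.closure A :=
    M.closure_subset_closure Set.inter_subset_right (hbasis.subset_closure (Set.mem_insert _ _))
  rw [(hS.admissible.isFlat_setOf_lt hω hx).closure] at hxA
  exact lt_irrefl (oddExt ω x) hxA

theorem IsRankedSymplectic.isFlat_of_signedVec_mem_normalCone (hS : IsRankedSymplectic S M)
    (hω : ω ∈ flatVectors M) (hG : AdmissibleSet G)
    (hGω : signedVec G ∈ normalCone (signedVec '' S) ω) : M.IsFlat G := by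
  have hM := hS.admissible
  by_contra hGf
  have hmax : ∀ B ∈ S, signedVec B ∈ maxFace (signedVec '' S) ω →
      M.IsBasis (B ∩ G) G ∧ B ∩ Sum.swap ⁻¹' G = ∅ := fun B hB hBω => by
    rw [← Set.ncard_eq_zero, ← hM.defect_eq_zero_of_not_isFlat hG hGf]
    exact (hS.signedVec_mem_maxFace_signedVec_iff hB hG).1 (mem_normalCone.1 hGω hBω)
  have hpos : G ⊆ {a | 0 < oddExt ω a} := by
    intro g hg
    by_contra hle
    have hle : ¬ 0 < oddExt ω g := hle
    obtain ⟨B, hB, hBω, hgB⟩ := hS.exists_mem_maxFace_of_nonneg hω (x := g.swap) (by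
      rw [oddExt_swap]
      linarith)
    exact (hmax B hB hBω).2.subset ⟨hgB, by simpa using hg⟩
  have hclosure : M.closure G ⊆ {a | 0 < oddExt ω a} := by
    rw [← (hM.isFlat_setOf_lt hω le_rfl).closure]
    exact M.closure_subset_closure hpos
  obtain ⟨x, hx, hxG⟩ : ∃ x ∈ M.closure G, x ∉ G := by
    by_contra! h
    exact hGf ((hM.subset_closure G).antisymm h ▸ M.isFlat_closure G)
  obtain ⟨B, hB, hBω, hxB⟩ := hS.exists_mem_maxFace_of_nonneg hω (le_of_lt (hclosure hx))
  rw [← (hmax B hB hBω).1.closure_eq_closure] at hx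
  exact hxG (((hS.mem_iff.1 hB).1.indep.closure_inter_eq_self_of_subset
    Set.inter_subset_left).subset ⟨hx, hxB⟩).2

theorem IsRankedSymplectic.normalCone_subset_flatVectors (hS : IsRankedSymplectic S M)
    (hω : ω ∈ flatVectors M) :
    (normalCone (signedVec '' S) ω : Set (Fin n → ℝ)) ⊆ flatVectors M := fun _ hν _ hG =>
  hS.isFlat_of_signedVec_mem_normalCone hω (admissibleSet_of_mem_levels hG)
    ((mem_normalCone.1 hν).trans (mem_normalCone.1 (hS.signedVec_mem_normalCone hG)))

end RankedSymplectic

section BergmanFan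

variable {n : ℕ} {S : Set (Set (SignedGround n))} {M : Matroid (SignedGround n)}

theorem mem_latticeOfFlats_sdiff {F : Set (SignedGround n)} :
    F ∈ latticeOfFlats M \ {∅, Set.univ} ↔ M.IsFlat F ∧ AdmissibleSet F ∧ F.Nonempty := by
  constructor
  · rintro ⟨⟨hF, hFa⟩ | hF, hne⟩
    · exact ⟨hF, hFa, Set.nonempty_iff_ne_empty.2 fun h => hne (Or.inl h)⟩
    · exact absurd (Or.inr hF) hne
  · rintro ⟨hF, hFa, a, ha⟩
    refine ⟨Or.inl ⟨hF, hFa⟩, ?_⟩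
    rintro (rfl | rfl)
    · exact ha
    · exact hFa a ha (Set.mem_univ _)

theorem eq_hull_inter_of_isFaceOf {R E : Type*} [Semiring R] [PartialOrder R] [IsOrderedRing R]
    [AddCommGroup E] [Module R E] {s : Set E} {τ : PointedCone R E}
    (hτ : τ.IsFaceOf (PointedCone.hull R s)) : τ = PointedCone.hull R (s ∩ τ) := by
  refine le_antisymm (fun x hx => ?_) (Submodule.span_le.2 Set.inter_subset_right)
  have hxs := hτ.le hx
  induction hxs using Submodule.span_induction with
  | mem x hxs => exact PointedCone.subset_hull ⟨hxs, hx⟩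
  | zero => exact zero_mem _
  | add x y hxs hys ihx ihy =>
    exact add_mem (ihx (hτ.mem_of_add_mem_left hxs hys hx))
      (ihy (hτ.mem_of_add_mem_right hxs hys hx))
  | smul a x hxs ih =>
    rcases eq_or_lt_of_le a.2 with ha | ha
    · obtain rfl : a = 0 := Subtype.ext ha.symm
      simp
    · refine Submodule.smul_mem _ a (ih ?_)
      refine hτ.mem_of_smul_add_mem (a := (a : R)) hxs (zero_mem _) ha ?_
      rw [add_zero]
      exact hx

theorem isFaceOf_inf_hull_signedVec {𝓕 𝓖 : Set (Set (SignedGround n))}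
    (h𝓕 : IsChain (· ⊆ ·) 𝓕) (h𝓖 : IsChain (· ⊆ ·) 𝓖) (h𝓕a : ∀ F ∈ 𝓕, AdmissibleSet F)
    (h𝓖a : ∀ G ∈ 𝓖, AdmissibleSet G) :
    (PointedCone.hull ℝ (signedVec '' 𝓕) ⊓ PointedCone.hull ℝ (signedVec '' 𝓖)).IsFaceOf
      (PointedCone.hull ℝ (signedVec '' 𝓕)) := by
  refine ⟨inf_le_left, fun {x y a} hx hy ha hxy => ⟨hx, ?_⟩⟩
  have hxy := (Submodule.mem_inf.1 hxy).2
  rw [SetLike.mem_coe] at *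
  rw [mem_hull_iff_levels_subset h𝓕 h𝓕a] at hx hy
  rw [mem_hull_iff_levels_subset h𝓖 h𝓖a] at hxy ⊢
  rw [← levels_smul ha x] at hx ⊢
  rw [levels_add (h𝓕.mono (Set.union_subset hx hy))] at hxy
  exact Set.subset_union_left.trans hxy

theorem isFan_bergmanFan (M : Matroid (SignedGround n)) : IsFan (bergmanFan M) where
  finite := (Set.finite_range fun 𝓕 : Set (Set (SignedGround n)) =>
    PointedCone.hull ℝ (signedVec '' 𝓕)).subset fun _ ⟨𝓕, _, _, h⟩ => ⟨𝓕, h.symm⟩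
  fg := by
    rintro _ ⟨𝓕, -, -, rfl⟩
    exact Submodule.fg_span (Set.toFinite _)
  face_mem := by
    rintro _ ⟨𝓕, h𝓕, hchain, rfl⟩ τ hτ
    refine ⟨𝓕 ∩ signedVec ⁻¹' τ, Set.inter_subset_left.trans h𝓕,
      hchain.mono Set.inter_subset_left, ?_⟩
    rw [Set.image_inter_preimage]
    exact eq_hull_inter_of_isFaceOf hτ
  inter_face := by
    rintro _ ⟨𝓕, h𝓕, h𝓕c, rfl⟩ _ ⟨𝓖, h𝓖, h𝓖c, rfl⟩
    have h𝓕a : ∀ F ∈ 𝓕, AdmissibleSet F := fun F hF => (mem_latticeOfFlats_sdiff.1 (h𝓕 hF)).2.1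
    have h𝓖a : ∀ G ∈ 𝓖, AdmissibleSet G := fun G hG => (mem_latticeOfFlats_sdiff.1 (h𝓖 hG)).2.1
    refine ⟨isFaceOf_inf_hull_signedVec h𝓕c h𝓖c h𝓕a h𝓖a, ?_⟩
    rw [inf_comm]
    exact isFaceOf_inf_hull_signedVec h𝓖c h𝓕c h𝓖a h𝓕a

theorem fanSupport_bergmanFan (M : Matroid (SignedGround n)) :
    fanSupport (bergmanFan M) = flatVectors M := by
  ext ω
  simp only [fanSupport, Set.mem_iUnion, SetLike.mem_coe, exists_prop]
  constructor
  · rintro ⟨_, ⟨𝓕, h𝓕, hchain, rfl⟩, hω⟩ G hG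
    rw [mem_hull_iff_levels_subset hchain fun F hF =>
      (mem_latticeOfFlats_sdiff.1 (h𝓕 hF)).2.1] at hω
    exact (mem_latticeOfFlats_sdiff.1 (h𝓕 (hω hG))).1
  · intro hω
    exact ⟨_, ⟨levels ω, fun G hG => mem_latticeOfFlats_sdiff.2
        ⟨hω G hG, admissibleSet_of_mem_levels hG, hG.1⟩, isChain_levels ω, rfl⟩,
      (mem_hull_iff_levels_subset (isChain_levels ω) fun G hG =>
        admissibleSet_of_mem_levels hG).2 subset_rfl⟩

theorem IsRankedSymplectic.exists_le_normalCone (hS : IsRankedSymplectic S M)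
    {σ : PointedCone ℝ (Fin n → ℝ)} (hσ : σ ∈ bergmanFan M) :
    ∃ ω ∈ σ, σ ≤ normalCone (signedVec '' S) ω := by
  obtain ⟨𝓕, h𝓕, hchain, rfl⟩ := hσ
  have hsupp : Function.support (𝓕.indicator (1 : Set (SignedGround n) → ℝ)) = 𝓕 := by simp
  have hc : 0 ≤ 𝓕.indicator (1 : Set (SignedGround n) → ℝ) :=
    Set.indicator_nonneg fun _ _ => zero_le_one
  refine ⟨∑ F, 𝓕.indicator (1 : Set (SignedGround n) → ℝ) F • signedVec F, ?_, ?_⟩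
  · refine Submodule.sum_mem _ fun F _ => ?_
    by_cases hF : F ∈ 𝓕
    · simpa [hF] using PointedCone.subset_hull (Set.mem_image_of_mem _ hF)
    · simp [hF]
  · refine Submodule.span_le.2 (Set.forall_mem_image.2 fun F hF => mem_normalCone.2 fun x hx => ?_)
    refine (hS.mem_maxFace_sum_iff hc (by rwa [hsupp]) ?_ hx.1).1 hx F (by rwa [hsupp])
    exact fun G hG => (mem_latticeOfFlats_sdiff.1 (h𝓕 (by rwa [hsupp] at hG))).2.1

end BergmanFan

theorem theorem5p5 (n : ℕ) (S : Set (Set (SignedGround n))) (M : Matroid (SignedGround n))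
    (hS : IsRankedSymplectic S M) :
    ∃ X : Set (PointedCone ℝ (Fin n → ℝ)),
      IsSubfan X (normalFan (matroidPolytope S)) ∧ FanRefines (bergmanFan M) X := by
  have hfan : IsFan (normalCone (signedVec '' S) '' flatVectors M) :=
    isFan_image_normalCone (Set.toFinite _) (hS.nonempty.image _)
      (fun ω hω => hS.normalCone_subset_flatVectors hω) fun ω _ => hS.normalCone_fg ω
  have hsupport : fanSupport (normalCone (signedVec '' S) '' flatVectors M) = flatVectors M :=
    fanSupport_image_normalCone fun ω hω => hS.normalCone_subset_flatVectors hω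
  refine ⟨normalCone (signedVec '' S) '' flatVectors M, ⟨?_, hfan⟩, isFan_bergmanFan M, hfan,
    (fanSupport_bergmanFan M).trans hsupport.symm, fun σ hσ => ?_⟩
  · rw [normalFan, matroidPolytope, normalCone_convexHull]
    exact Set.image_subset_range _ _
  · obtain ⟨ω, hωσ, hσω⟩ := hS.exists_le_normalCone hσ
    have hω : ω ∈ flatVectors M := fanSupport_bergmanFan M ▸ Set.mem_biUnion hσ hωσ
    exact ⟨_, Set.mem_image_of_mem _ hω, hσω⟩
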